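/- Let $S$ be a finite set of states and, for each $s\in S$, let $A_s$ be a finite set of actions; write $\Delta(s)$ for the probability simplex on $A_s$. The uncertain parameters of a state $s$ are $(\mathbf p_s,\mathbf r_s)$, where $\mathbf p_s=(p(s'|s,a))_{a\in A_s,\,s'\in S}$ consists of probability vectors $p(\cdot|s,a)$ on $S$ and $\mathbf r_s=(r(s,a))_{a\in A_s}\in\mathbb R^{A_s}$. For each $s$ let $Q_s,k_s\ge 0$ and $n_s\ge 1$ be integers, $F_s,G_s,H_s$ real matrices with $k_s$ rows, $\mathbf c_s\in\mathbb R^{k_s}$, $O_s^i\subseteq\mathbb R^{A_s\times S}\times\mathbb R^{A_s}\times\mathbb R^{Q_s}$ confidence sets, and $0\le\underline\alpha_s^i\le\overline\alpha_s^i\le1$ for $i=1,\dots,n_s$. Let $\tilde{\mathcal C}_s$ be the set of all probability distributions $\mu_s$ of $(\mathbf p_s,\mathbf r_s,\tilde{\mathbf u}_s)$, with $\tilde{\mathbf u}_s\in\mathbb R^{Q_s}$ an auxiliary vector, such that $\mathbb E_{\mu_s}[F_s\mathbf p_s+G_s\mathbf r_s+H_s\tilde{\mathbf u}_s]=\mathbf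 c_s$ (the expectation being required to exist) and $\mu_s(O_s^i)\in[\underline\alpha_s^i,\overline\alpha_s^i]$ for all $i$, and let $\mathcal C_s$ be the set of the corresponding marginal distributions of $(\mathbf p_s,\mathbf r_s)$. Assume that each $O_s^i$ is nonempty, convex and of the form $\{(\mathbf p,\mathbf r,\mathbf u): B\mathbf p+D\mathbf r+E\mathbf u\preceq_K\mathbf b\}$ for some matrices $B,D,E$, a vector $\mathbf b$ and a proper cone $K$ (closed, convex, pointed, with nonempty interior), all depending on $(s,i)$; and that $O_s^{n_s}$ is bounded with $\underline\alpha_s^{n_s}=\overline\alpha_s^{n_s}=1$ for each $s$. Let $0\le\gamma<1$. A (history-dependent randomized) strategy $\pi$ prescribes, for every stage $t$, every history of the states and actions before stage $t$ and every current state $s$, an element of $\Delta(s)$. For an initial state $s_0$ and parameters $(\mathbf p_{s,t},\mathbf r_{s,t})$ of each state $s$ at each stage $t$, let $u(\pi,\mathbf p,\mathbf r)$ be the expectation of $\sum_{t\ge1}\gamma^{t-1}r_t(s_t,a_t)$ for the state-action process started at $s_0$, controlled by $\pi$ and with transition probabilities $p_t(\cdot|s_t,a_t)$ at stage $t$; and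 let $w(\pi,\mu,s_0)=\mathbb E_{(\mathbf p,\mathbf r)\sim\mu}\,u(\pi,\mathbf p,\mathbf r)$ for a distribution $\mu$ of the parameters. The stationary ambiguity set is $$\overline{\mathcal C}_S=\Big\{\mu=\bigotimes_{s\in S,\,t=1,2,\dots}\mu_{s,t}\ :\ \mu_{s,t}=\mu_s\text{ for all }t,\ \mu_s\in\mathcal C_s\text{ for all }s\Big\},$$ that is, the parameters of the different pairs $(s,t)$ are independent, and those of a state have the same distribution at every stage. Suppose that $\tilde v:S\to\mathbb R$ satisfies, for all $s\in S$, $$\tilde v(s)=\max_{d\in\Delta(s)}\ \inf_{\mu_s\in\mathcal C_s}\ \mathbb E_{(\mathbf p_s,\mathbf r_s)\sim\mu_s}\Big[\sum_{a\in A_s}d(a)\Big(r(s,a)+\gamma\sum_{s'\in S}p(s'|s,a)\tilde v(s')\Big)\Big],$$ and let $\pi^*$ be an S-robust strategy: for every history and every current state $s$, the element of $\Delta(s)$ that $\pi^*$ prescribes attains this maximum. (In particular, $\pi^*$ may be a stationary strategy $(\pi^*_s)_{s\in S}$ whose actions $\pi^*_s$ attain the maximum.) Then, for every initial state $s_0\in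 S$, $\pi^*$ is distributionally robust with respect to $\overline{\mathcal C}_S$: for every strategy $\pi$, $$\inf_{\mu\in\overline{\mathcal C}_S}w(\pi,\mu,s_0)\ \le\ \inf_{\mu\in\overline{\mathcal C}_S}w(\pi^*,\mu,s_0).$$ -/

import Mathlib

open MeasureTheory ProbabilityTheory

/-! Distributionally ambiguous Markov decision processes with finite state set `S` and finite
action sets `A s`, over an infinite discounted horizon.  Stages are numbered `0, 1, 2, …`, so that
the reward of stage `t` carries the factor `γ ^ t`. -/

noncomputable section

namespace DAMDP

/-- State-action pairs `(s, a)` with `a ∈ A s`. -/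
structure StateAction (S : Type*) (A : S → Type*) where
  state : S
  action : A state

instance (S : Type*) (A : S → Type*) : MeasurableSpace (StateAction S A) := ⊤

instance (S : Type*) (A : S → Type*) : DiscreteMeasurableSpace (StateAction S A) :=
  ⟨fun _ => trivial⟩

instance (S : Type*) (A : S → Type*) [Finite S] [∀ s, Finite (A s)] : Finite (StateAction S A) :=
  Finite.of_injective (β := Σ s, A s) (fun x => ⟨x.state, x.action⟩)
    (by rintro ⟨s, a⟩ ⟨s', a'⟩ h; cases h; rfl)

section Defs

variable {S : Type*} {A : S → Type*} [Fintype S] [∀ s, Fintype (A s)]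

/-! ### Parameters and ambiguity sets -/

variable (A) in
/-- Parameters `(p_s, r_s)` of the state `s`: for every action `a`, the transition probabilities
`p (· | s, a)`, which form a probability vector on `S`, and the reward `r (s, a)`. -/
abbrev Param (s : S) : Type _ := (A s → stdSimplex ℝ S) × (A s → ℝ)

variable (A) in
/-- Parameters `(p_s, r_s, u_s)` of the state `s` with an auxiliary vector `u_s ∈ ℝ^Q`. -/
abbrev LiftedParam (Q : ℕ) (s : S) : Type _ :=
  (A s → stdSimplex ℝ S) × (A s → ℝ) × (Fin Q → ℝ)

variable (A) in
/-- The Euclidean space `ℝ^{A_s × S} × ℝ^{A_s} × ℝ^Q` that contains the confidence sets. -/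
abbrev Ambient (Q : ℕ) (s : S) : Type _ := (A s × S → ℝ) × (A s → ℝ) × (Fin Q → ℝ)

/-- A lifted parameter as a point of the ambient Euclidean space. -/
def LiftedParam.toAmbient {Q : ℕ} {s : S} (θ : LiftedParam A Q s) : Ambient A Q s :=
  (fun as => θ.1 as.1 as.2, θ.2.1, θ.2.2)

variable (S A) in
/-- The data that specify the state-wise (lifted) ambiguity sets: the mean constraints
`E[F_s p_s + G_s r_s + H_s u_s] = c_s` and the confidence sets `O_s^i` with probability bounds.
The index set of the confidence sets of `s` is `{0, …, n s}`. -/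
structure AmbiguityData where
  Q : S → ℕ
  k : S → ℕ
  F : ∀ s, Matrix (Fin (k s)) (A s × S) ℝ
  G : ∀ s, Matrix (Fin (k s)) (A s) ℝ
  H : ∀ s, Matrix (Fin (k s)) (Fin (Q s)) ℝ
  c : ∀ s, Fin (k s) → ℝ
  n : S → ℕ
  O : ∀ s, Fin (n s + 1) → Set (Ambient A (Q s) s)
  αlo : ∀ s, Fin (n s + 1) → ℝ
  αhi : ∀ s, Fin (n s + 1) → ℝ
  αlo_nonneg : ∀ s i, 0 ≤ αlo s i
  αlo_le_αhi : ∀ s i, αlo s i ≤ αhi s i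
  αhi_le_one : ∀ s i, αhi s i ≤ 1

namespace AmbiguityData

variable (D : AmbiguityData S A)

/-- The random vector `F_s p_s + G_s r_s + H_s u_s`. -/
def meanVector (s : S) (z : Ambient A (D.Q s) s) : Fin (D.k s) → ℝ :=
  (D.F s).mulVec z.1 + (D.G s).mulVec z.2.1 + (D.H s).mulVec z.2.2

/-- The state-wise ambiguity set of joint distributions of `(p_s, r_s, u_s)`. -/
def liftedAmbiguitySet (s : S) : Set (Measure (LiftedParam A (D.Q s) s)) :=
  {μ | IsProbabilityMeasure μ ∧
    Integrable (fun θ => D.meanVector s θ.toAmbient) μ ∧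
    ∫ θ, D.meanVector s θ.toAmbient ∂μ = D.c s ∧
    ∀ i, μ.real {θ | θ.toAmbient ∈ D.O s i} ∈ Set.Icc (D.αlo s i) (D.αhi s i)}

/-- The state-wise ambiguity set of distributions of `(p_s, r_s)`: the marginals of the members of
the lifted ambiguity set. -/
def ambiguitySet (s : S) : Set (Measure (Param A s)) :=
  (fun μ => μ.map (fun θ => (θ.1, θ.2.1))) '' D.liftedAmbiguitySet s

/-- A proper cone: closed, convex, pointed, with nonempty interior. -/
def IsProperCone {L : ℕ} (K : PointedCone ℝ (Fin L → ℝ)) : Prop :=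
  IsClosed (K : Set (Fin L → ℝ)) ∧ (∀ x ∈ K, -x ∈ K → x = 0) ∧
    (interior (K : Set (Fin L → ℝ))).Nonempty

/-- Every confidence set is nonempty, convex, and given by a conic inequality
`B p_s + D r_s + E u_s ⪯_K b` with respect to a proper cone `K`. -/
def ConicRepresentable : Prop :=
  ∀ s i, (D.O s i).Nonempty ∧ Convex ℝ (D.O s i) ∧
    ∃ (L : ℕ) (B : Matrix (Fin L) (A s × S) ℝ) (R : Matrix (Fin L) (A s) ℝ)
      (E : Matrix (Fin L) (Fin (D.Q s)) ℝ) (b : Fin L → ℝ) (K : PointedCone ℝ (Fin L → ℝ)),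
      IsProperCone K ∧
      D.O s i = {z | b - (B.mulVec z.1 + R.mulVec z.2.1 + E.mulVec z.2.2) ∈ K}

/-- The confidence set of largest index is bounded and has probability one. -/
def BoundedSupport : Prop :=
  ∀ s, Bornology.IsBounded (D.O s (Fin.last (D.n s))) ∧
    D.αlo s (Fin.last (D.n s)) = 1 ∧ D.αhi s (Fin.last (D.n s)) = 1

/-- The stationary ambiguity set: the parameters of the pairs `(s, t)` (state, stage) are
independent, and the distribution of the parameters of `(s, t)` is a member `m s` of the
state-wise ambiguity set of `s` that does not depend on the stage `t`. -/
def stationaryAmbiguitySet : Set (Measure (∀ st : S × ℕ, Param A st.1)) :=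
  {μ | ∃ m : ∀ s, Measure (Param A s), (∀ s, m s ∈ D.ambiguitySet s) ∧
    μ = Measure.infinitePi (fun st : S × ℕ => m st.1)}

end AmbiguityData

/-! ### Strategies and expected performance -/

variable (A) in
/-- History-dependent randomized strategies: a distribution on `A s` for every stage `t`, every
history of the state-action pairs of the stages before `t`, and every current state `s`. -/
def Strategy : Type _ :=
  ∀ t : ℕ, (Fin t → StateAction S A) → ∀ s : S, stdSimplex ℝ (A s)

/-- The mixture of the measures `m i` with weights `q i`. -/
def weightMeasure {ι X : Type*} [Fintype ι] [MeasurableSpace X] (q : stdSimplex ℝ ι)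
    (m : ι → Measure X) : Measure X :=
  ∑ i, ENNReal.ofReal (q i) • m i

instance {ι X : Type*} [Fintype ι] [MeasurableSpace X] (q : stdSimplex ℝ ι)
    (m : ι → Measure X) [∀ i, IsProbabilityMeasure (m i)] :
    IsProbabilityMeasure (weightMeasure q m) := by
  constructor
  have h : ∑ i, ENNReal.ofReal (q i) = 1 := by
    have h0 : ∀ i ∈ Finset.univ, 0 ≤ q i := fun i _ => q.2.1 i
    have h1 : ∑ i, q i = 1 := q.2.2
    rw [← ENNReal.ofReal_sum_of_nonneg h0, h1, ENNReal.ofReal_one]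
  simpa [weightMeasure] using h

/-- The law of the state-action pair in state `s` when the action is drawn from `d`. -/
def actionLaw (s : S) (d : stdSimplex ℝ (A s)) : Measure (StateAction S A) :=
  weightMeasure d (fun a => Measure.dirac ⟨s, a⟩)

instance (s : S) (d : stdSimplex ℝ (A s)) : IsProbabilityMeasure (actionLaw s d) := by
  unfold actionLaw; infer_instance

/-- The conditional law of the state-action pair of stage `t + 1` given those of the stages
`0, …, t`: the state is drawn from `p_t (· | s_t, a_t)` and the action from the strategy. -/
def stepKernel (π : Strategy A) (θ : ∀ st : S × ℕ, Param A st.1) (t : ℕ) :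
    Kernel (∀ _ : Finset.Iic t, StateAction S A) (StateAction S A) :=
  Kernel.ofFunOfCountable fun h =>
    let x := h ⟨t, Finset.mem_Iic.2 le_rfl⟩
    weightMeasure ((θ (x.state, t)).1 x.action) fun s' =>
      actionLaw s' (π (t + 1) (fun i => h ⟨i, Finset.mem_Iic.2 (Nat.lt_succ_iff.1 i.2)⟩) s')

instance (π : Strategy A) (θ : ∀ st : S × ℕ, Param A st.1) (t : ℕ) :
    IsMarkovKernel (stepKernel π θ t) := by
  constructor
  intro h
  change IsProbabilityMeasure (weightMeasure _ _)
  infer_instance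

/-- The law of the trajectory `(s_0, a_0), (s_1, a_1), …` with `s_0` the given initial state, under
the strategy `π`, when the parameters of the state `s` at the stage `t` are `θ (s, t)`. -/
def trajectoryLaw (π : Strategy A) (θ : ∀ st : S × ℕ, Param A st.1) (s₀ : S) :
    Measure (ℕ → StateAction S A) :=
  ((actionLaw s₀ (π 0 Fin.elim0 s₀)).map (fun x => fun _ : Finset.Iic 0 => x)).bind
    (Kernel.traj (X := fun _ => StateAction S A) (stepKernel π θ) 0)

/-- The expected discounted total reward for given parameters. -/
def expectedReward (γ : ℝ) (π : Strategy A) (θ : ∀ st : S × ℕ, Param A st.1) (s₀ : S) : ℝ :=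
  ∫ x, ∑' t : ℕ, γ ^ t * (θ ((x t).state, t)).2 (x t).action ∂(trajectoryLaw π θ s₀)

/-- The expected performance when the parameters are distributed according to `μ`. -/
def performance (γ : ℝ) (π : Strategy A) (μ : Measure (∀ st : S × ℕ, Param A st.1)) (s₀ : S) : ℝ :=
  ∫ θ, expectedReward γ π θ s₀ ∂μ

/-- `π` is distributionally robust with respect to the set `C` of distributions of the parameters:
it maximizes the worst-case expected performance among all strategies. -/
def IsDistributionallyRobust (γ : ℝ) (C : Set (Measure (∀ st : S × ℕ, Param A st.1))) (s₀ : S)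
    (π : Strategy A) : Prop :=
  ∀ π' : Strategy A, (⨅ μ ∈ C, (performance γ π' μ s₀ : EReal)) ≤
    (⨅ μ ∈ C, (performance γ π μ s₀ : EReal))

/-! ### S-robust strategies -/

/-- The expectation over `(p_s, r_s) ∼ μ` of `r (s, a) + γ v (s')`, where `a` is drawn from `d` and
the next state `s'` from `p_s (· | s, a)`. -/
def oneStepValue (γ : ℝ) (v : S → ℝ) (s : S) (d : stdSimplex ℝ (A s)) (μ : Measure (Param A s)) :
    ℝ :=
  ∫ θ, ∑ a, d a * (θ.2 a + γ * ∑ s', θ.1 a s' * v s') ∂μ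

/-- The worst case of the one-step value over the state-wise ambiguity set. -/
def worstOneStepValue (D : AmbiguityData S A) (γ : ℝ) (v : S → ℝ) (s : S)
    (d : stdSimplex ℝ (A s)) : EReal :=
  ⨅ μ ∈ D.ambiguitySet s, (oneStepValue γ v s d μ : EReal)

/-- `v` solves the fixed-point equation of the S-robust value. -/
def IsSRobustValue (D : AmbiguityData S A) (γ : ℝ) (v : S → ℝ) : Prop :=
  ∀ s, IsGreatest (Set.range (worstOneStepValue D γ v s)) (v s : EReal)

/-- `d` is an S-robust action of the state `s`, for the S-robust value `v`. -/
def IsSRobustAction (D : AmbiguityData S A) (γ : ℝ) (v : S → ℝ) (s : S)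
    (d : stdSimplex ℝ (A s)) : Prop :=
  ∀ d' : stdSimplex ℝ (A s), worstOneStepValue D γ v s d' ≤ worstOneStepValue D γ v s d

/-- `π` is an S-robust strategy: for every state and every history that ends in that state, it
plays an S-robust action.  Stationary strategies are those that ignore the stage and the history. -/
def IsSRobustStrategy (D : AmbiguityData S A) (γ : ℝ) (π : Strategy A) : Prop :=
  ∃ v : S → ℝ, IsSRobustValue D γ v ∧ ∀ t h s, IsSRobustAction D γ v s (π t h s)

end Defs

end DAMDP

end

noncomputable section

namespace DAMDP

/-! A trajectory consults one parameter vector per stage, and those of different stages are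
independent. The probability of a history is thus a product of independent factors, and the expected
performance under a product measure is the discounted reward for the mean parameters
(`performance_infinitePi`), even though strategies depend on histories. These means are the same at
all stages.

Both sides of the claim are then compared with `v s₀`. S-robust actions secure at least `v s` in one
step against every member of the ambiguity set; discounting and telescoping give `le_performance`.
Conversely, the ambiguity set of a state is convex, so a minimax argument yields, for every `ε > 0`,
one member against which every action is worth less than `v s + ε`
(`IsSRobustValue.exists_forall_actionValue_lt`). Used at all stages, these members hold every
strategy to `v s₀ + ε / (1 - γ)` (`performance_le`). The `ε` is needed since the infimum over the
ambiguity set need not be attained.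

Bounded support makes rewards almost surely bounded, which justifies every exchange of sum and
integral. -/

instance {S : Type*} {A : S → Type*} [Fintype S] [∀ s, Fintype (A s)] :
    Fintype (StateAction S A) := Fintype.ofFinite _

set_option linter.unusedSectionVars false

/-! ### Occupation probabilities and discounted rewards for fixed parameters. -/

section Occupation

variable {S : Type*} {A : S → Type*} [Fintype S] [∀ s, Fintype (A s)]

lemma sum_stateAction (g : StateAction S A → ℝ) : ∑ x, g x = ∑ s, ∑ a, g ⟨s, a⟩ := by
  rw [← Fintype.sum_sigma' (fun s a => g ⟨s, a⟩)]
  refine (Fintype.sum_equiv ⟨fun y : Σ s, A s => (⟨y.1, y.2⟩ : StateAction S A),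
    fun x => ⟨x.state, x.action⟩, fun _ => rfl, fun _ => rfl⟩ _ _ fun _ => rfl).symm

open Classical in
/-- The probability that the state-action pairs of the stages before `t` are `h` and that the
state of the stage `t` is `s`, when the transition probabilities of the stage `t` are
`P (·, t)`. -/
def occupation (π : Strategy A) (P : ∀ st : S × ℕ, A st.1 → S → ℝ) (s₀ : S) :
    ∀ t : ℕ, (Fin t → StateAction S A) → S → ℝ
  | 0, _, s => if s = s₀ then 1 else 0
  | t + 1, h, s =>
    occupation π P s₀ t (Fin.init h) (h (Fin.last t)).state *
      π t (Fin.init h) (h (Fin.last t)).state (h (Fin.last t)).action *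
      P ((h (Fin.last t)).state, t) (h (Fin.last t)).action s

/-- The expectation of `f` under the occupation probabilities of the stage `t`. -/
def occupationMean (π : Strategy A) (P : ∀ st : S × ℕ, A st.1 → S → ℝ) (s₀ : S) (t : ℕ)
    (f : (Fin t → StateAction S A) → S → ℝ) : ℝ :=
  ∑ h, ∑ s, occupation π P s₀ t h s * f h s

variable {π : Strategy A} {P : ∀ st : S × ℕ, A st.1 → S → ℝ} {s₀ : S}

lemma occupationMean_zero (f : (Fin 0 → StateAction S A) → S → ℝ) :
    occupationMean π P s₀ 0 f = f Fin.elim0 s₀ := by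
  classical
  simp [occupationMean, occupation, Subsingleton.elim default (Fin.elim0 : Fin 0 → StateAction S A)]

lemma occupation_snoc (t : ℕ) (h : Fin t → StateAction S A) (x : StateAction S A) (s : S) :
    occupation π P s₀ (t + 1) (Fin.snoc h x) s =
      occupation π P s₀ t h x.state * π t h x.state x.action * P (x.state, t) x.action s := by
  -- The type of the action depends on the state, so the history and the last pair are replaced as
  -- whole variables.
  have key : ∀ (h' : Fin t → StateAction S A) (y : StateAction S A), h' = h → y = x →
      occupation π P s₀ t h' y.state * π t h' y.state y.action * P (y.state, t) y.action s =
        occupation π P s₀ t h x.state * π t h x.state x.action * P (x.state, t) x.action s := by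
    rintro _ _ rfl rfl; rfl
  exact key _ _ (Fin.init_snoc (α := fun _ => StateAction S A) x h) (Fin.snoc_last (α := fun _ => StateAction S A) x h)

/-- The tower property: condition on the history and state of stage `t`. -/
lemma occupationMean_succ (t : ℕ) (f : (Fin (t + 1) → StateAction S A) → S → ℝ) :
    occupationMean π P s₀ (t + 1) f =
      occupationMean π P s₀ t fun h s =>
        ∑ a, π t h s a * ∑ s', P (s, t) a s' * f (Fin.snoc h ⟨s, a⟩) s' := by
  unfold occupationMean
  rw [← (Fin.snocEquiv fun _ => StateAction S A).sum_comp, Fintype.sum_prod_type_right]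
  refine Finset.sum_congr rfl fun h _ => ?_
  rw [sum_stateAction]
  refine Finset.sum_congr rfl fun s _ => ?_
  rw [Finset.mul_sum]
  refine Finset.sum_congr rfl fun a _ => ?_
  rw [← mul_assoc, Finset.mul_sum]
  refine Finset.sum_congr rfl fun s' _ => ?_
  change occupation π P s₀ (t + 1) (Fin.snoc h ⟨s, a⟩) s' * f (Fin.snoc h ⟨s, a⟩) s' = _
  rw [occupation_snoc, mul_assoc]

lemma occupationMean_const (hP : ∀ st a, ∑ s', P st a s' = 1) (t : ℕ) (c : ℝ) :
    occupationMean π P s₀ t (fun _ _ => c) = c := by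
  induction t with
  | zero => exact occupationMean_zero _
  | succ t ih =>
    rw [occupationMean_succ]
    simpa [← Finset.sum_mul, hP] using ih

lemma occupation_nonneg (hP : ∀ st a s', 0 ≤ P st a s') (t : ℕ) (h : Fin t → StateAction S A)
    (s : S) : 0 ≤ occupation π P s₀ t h s := by
  induction t generalizing s with
  | zero => simp only [occupation]; split_ifs <;> norm_num
  | succ t ih => exact mul_nonneg (mul_nonneg (ih _ _) (stdSimplex.zero_le _ _)) (hP _ _ _)

lemma occupationMean_mono (hP : ∀ st a s', 0 ≤ P st a s') {t : ℕ}
    {f g : (Fin t → StateAction S A) → S → ℝ} (hfg : ∀ h s, f h s ≤ g h s) :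
    occupationMean π P s₀ t f ≤ occupationMean π P s₀ t g :=
  Finset.sum_le_sum fun h _ => Finset.sum_le_sum fun s _ =>
    mul_le_mul_of_nonneg_left (hfg h s) (occupation_nonneg hP t h s)

lemma occupationMean_add (t : ℕ) (f g : (Fin t → StateAction S A) → S → ℝ) :
    occupationMean π P s₀ t (fun h s => f h s + g h s) =
      occupationMean π P s₀ t f + occupationMean π P s₀ t g := by
  simp [occupationMean, mul_add, Finset.sum_add_distrib]

lemma occupationMean_const_mul (t : ℕ) (c : ℝ) (f : (Fin t → StateAction S A) → S → ℝ) :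
    occupationMean π P s₀ t (fun h s => c * f h s) = c * occupationMean π P s₀ t f := by
  simp [occupationMean, Finset.mul_sum, mul_left_comm]

lemma abs_occupationMean_le (hP₀ : ∀ st a s', 0 ≤ P st a s') (hP : ∀ st a, ∑ s', P st a s' = 1)
    {t : ℕ} {f : (Fin t → StateAction S A) → S → ℝ} {M : ℝ} (hf : ∀ h s, |f h s| ≤ M) :
    |occupationMean π P s₀ t f| ≤ M := by
  rw [abs_le]
  constructor
  · rw [← occupationMean_const (π := π) (s₀ := s₀) hP t (-M)]
    exact occupationMean_mono hP₀ fun h s => (abs_le.1 (hf h s)).1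
  · rw [← occupationMean_const (π := π) (s₀ := s₀) hP t M]
    exact occupationMean_mono hP₀ fun h s => (abs_le.1 (hf h s)).2

lemma abs_sum_stdSimplex_mul_le {ι : Type*} [Fintype ι] (d : stdSimplex ℝ ι) {f : ι → ℝ} {M : ℝ}
    (hf : ∀ i, |f i| ≤ M) : |∑ i, d i * f i| ≤ M := by
  calc |∑ i, d i * f i| ≤ ∑ i, |d i * f i| := Finset.abs_sum_le_sum_abs _ _
    _ ≤ ∑ i, d i * M := Finset.sum_le_sum fun i _ => by
        rw [abs_mul, abs_of_nonneg (stdSimplex.zero_le d i)]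
        exact mul_le_mul_of_nonneg_left (hf i) (stdSimplex.zero_le d i)
    _ = M := by rw [← Finset.sum_mul, stdSimplex.sum_eq_one, one_mul]

/-- The expected discounted total reward for fixed transition probabilities and rewards. -/
def discountedReward (γ : ℝ) (π : Strategy A) (P : ∀ st : S × ℕ, A st.1 → S → ℝ)
    (R : ∀ st : S × ℕ, A st.1 → ℝ) (s₀ : S) : ℝ :=
  ∑' t : ℕ, γ ^ t * occupationMean π P s₀ t fun h s => ∑ a, π t h s a * R (s, t) a

variable {R : ∀ st : S × ℕ, A st.1 → ℝ} {γ M : ℝ}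

lemma abs_stageReward_le (hP₀ : ∀ st a s', 0 ≤ P st a s') (hP : ∀ st a, ∑ s', P st a s' = 1)
    (hR : ∀ st a, |R st a| ≤ M) (t : ℕ) :
    |occupationMean π P s₀ t fun h s => ∑ a, π t h s a * R (s, t) a| ≤ M :=
  abs_occupationMean_le hP₀ hP fun h s => abs_sum_stdSimplex_mul_le (π t h s) (hR (s, t))

lemma summable_geometric_mul {γ : ℝ} (hγ₀ : 0 ≤ γ) (hγ₁ : γ < 1) {b : ℕ → ℝ} {M : ℝ}
    (hb : ∀ t, |b t| ≤ M) : Summable fun t => γ ^ t * b t := by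
  refine Summable.of_norm_bounded ((summable_geometric_of_lt_one hγ₀ hγ₁).mul_right M) fun t => ?_
  rw [Real.norm_eq_abs, abs_mul, abs_of_nonneg (pow_nonneg hγ₀ t)]
  exact mul_le_mul_of_nonneg_left (hb t) (pow_nonneg hγ₀ t)

/-- Multiplied by `γ ^ t` and summed, the `E` terms telescope to `E 0`, with no remainder at
infinity since `E` is bounded; the errors form a geometric series. It is applied with `E t` the mean
of `v` and `ρ t` the mean reward at stage `t`. -/
lemma sub_div_le_tsum_geometric_mul (hγ₀ : 0 ≤ γ) (hγ₁ : γ < 1) {E ρ : ℕ → ℝ} {V ε : ℝ}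
    (hE : ∀ t, |E t| ≤ V) (hρ : ∀ t, |ρ t| ≤ M) (hstep : ∀ t, E t - ε ≤ ρ t + γ * E (t + 1)) :
    E 0 - ε / (1 - γ) ≤ ∑' t, γ ^ t * ρ t := by
  have hsE : Summable fun t => γ ^ t * E t := summable_geometric_mul hγ₀ hγ₁ hE
  have hsR : Summable fun t => γ ^ t * ρ t := summable_geometric_mul hγ₀ hγ₁ hρ
  have hsE' : Summable fun t => γ ^ (t + 1) * E (t + 1) :=
    (summable_nat_add_iff (f := fun t => γ ^ t * E t) 1).2 hsE
  have hsγ := (summable_geometric_of_lt_one hγ₀ hγ₁).mul_right ε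
  have hle := Summable.tsum_le_tsum (fun t => ?_) ((hsE.sub hsE').sub hsγ) hsR
  · rw [(hsE.sub hsE').tsum_sub hsγ, hsE.tsum_sub hsE', hsE.tsum_eq_zero_add, tsum_mul_right,
      tsum_geometric_of_lt_one hγ₀ hγ₁, pow_zero, one_mul, add_sub_cancel_right,
      inv_mul_eq_div] at hle
    exact hle
  · have := mul_le_mul_of_nonneg_left (hstep t) (pow_nonneg hγ₀ t)
    rw [pow_succ]
    linarith

lemma occupationMean_le_stageReward_add (hP₀ : ∀ st a s', 0 ≤ P st a s')
    (hP : ∀ st a, ∑ s', P st a s' = 1) {v : S → ℝ} {ε : ℝ} {t : ℕ}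
    (hv : ∀ h s, v s - ε ≤ ∑ a, π t h s a * (R (s, t) a + γ * ∑ s', P (s, t) a s' * v s')) :
    (occupationMean π P s₀ t fun _ s => v s) - ε ≤
      (occupationMean π P s₀ t fun h s => ∑ a, π t h s a * R (s, t) a) +
        γ * occupationMean π P s₀ (t + 1) fun _ s => v s := by
  have h1 := occupationMean_mono (π := π) (s₀ := s₀) hP₀ hv
  have h2 : (occupationMean π P s₀ t fun _ s => v s - ε) =
      (occupationMean π P s₀ t fun _ s => v s) - ε := by
    simp only [sub_eq_add_neg]
    rw [occupationMean_add t (fun _ s => v s) (fun _ _ => -ε), occupationMean_const hP]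
  rw [occupationMean_succ, ← occupationMean_const_mul, ← occupationMean_add, ← h2]
  refine h1.trans_eq (congrArg _ ?_)
  funext h s
  rw [Finset.mul_sum, ← Finset.sum_add_distrib]
  refine Finset.sum_congr rfl fun a _ => ?_
  ring

/-- If the one-step values are at least `v - ε`, then the discounted reward is at least
`v - ε / (1 - γ)`. -/
lemma le_discountedReward (hγ₀ : 0 ≤ γ) (hγ₁ : γ < 1) (hP₀ : ∀ st a s', 0 ≤ P st a s')
    (hP : ∀ st a, ∑ s', P st a s' = 1) (hR : ∀ st a, |R st a| ≤ M) {v : S → ℝ} {ε : ℝ}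
    (hv : ∀ t h s, v s - ε ≤ ∑ a, π t h s a * (R (s, t) a + γ * ∑ s', P (s, t) a s' * v s')) :
    v s₀ - ε / (1 - γ) ≤ discountedReward γ π P R s₀ := by
  obtain ⟨V, hV⟩ : ∃ V, ∀ s, |v s| ≤ V :=
    ⟨∑ s, |v s|, fun s => Finset.single_le_sum (f := fun s => |v s|)
      (fun _ _ => abs_nonneg _) (Finset.mem_univ s)⟩
  have hbE : ∀ t, |occupationMean π P s₀ t fun _ s => v s| ≤ V :=
    fun t => abs_occupationMean_le hP₀ hP fun _ s => hV s
  have h := sub_div_le_tsum_geometric_mul hγ₀ hγ₁ hbE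
    (abs_stageReward_le (π := π) (s₀ := s₀) hP₀ hP hR)
    fun t => occupationMean_le_stageReward_add (π := π) (s₀ := s₀) hP₀ hP (hv t)
  rwa [occupationMean_zero] at h

/-- The lower bound applied to `-R` and `-v`. -/
lemma discountedReward_le (hγ₀ : 0 ≤ γ) (hγ₁ : γ < 1) (hP₀ : ∀ st a s', 0 ≤ P st a s')
    (hP : ∀ st a, ∑ s', P st a s' = 1) (hR : ∀ st a, |R st a| ≤ M) {v : S → ℝ} {ε : ℝ}
    (hv : ∀ t h s, ∑ a, π t h s a * (R (s, t) a + γ * ∑ s', P (s, t) a s' * v s') ≤ v s + ε) :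
    discountedReward γ π P R s₀ ≤ v s₀ + ε / (1 - γ) := by
  have h := le_discountedReward (π := π) (s₀ := s₀) (R := fun st a => -R st a)
    (v := fun s => -v s) (ε := ε) hγ₀ hγ₁ hP₀ hP (M := M) (by simpa using hR) fun t h s => by
      have h1 := hv t h s
      have h2 : ∑ a, π t h s a * (-R (s, t) a + γ * ∑ s', P (s, t) a s' * -v s') =
          -∑ a, π t h s a * (R (s, t) a + γ * ∑ s', P (s, t) a s' * v s') := by
        rw [← Finset.sum_neg_distrib]
        refine Finset.sum_congr rfl fun a _ => ?_
        simp only [mul_neg, Finset.sum_neg_distrib]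
        ring
      linarith
  have h3 : discountedReward γ π P (fun st a => -R st a) s₀ = -discountedReward γ π P R s₀ := by
    simp [discountedReward, occupationMean, tsum_neg]
  linarith

end Occupation

/-! ### From the trajectory measure to occupation probabilities. -/

section Trajectory

variable {S : Type*} {A : S → Type*} [Fintype S] [∀ s, Fintype (A s)]

lemma integral_weightMeasure {ι X : Type*} [Fintype ι] [MeasurableSpace X] (q : stdSimplex ℝ ι)
    (m : ι → Measure X) {g : X → ℝ} (hg : ∀ i, Integrable g (m i)) :
    ∫ x, g x ∂(weightMeasure q m) = ∑ i, q i * ∫ x, g x ∂(m i) := by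
  unfold weightMeasure
  rw [integral_finsetSum_measure fun i _ => (hg i).smul_measure ENNReal.ofReal_ne_top]
  refine Finset.sum_congr rfl fun i _ => ?_
  rw [integral_smul_measure, ENNReal.toReal_ofReal (stdSimplex.zero_le q i), smul_eq_mul]

lemma integral_actionLaw (s : S) (d : stdSimplex ℝ (A s)) (g : StateAction S A → ℝ) :
    ∫ x, g x ∂(actionLaw s d) = ∑ a, d a * g ⟨s, a⟩ := by
  unfold actionLaw
  rw [integral_weightMeasure _ _ fun _ => .of_finite]
  simp

/-- The transition probabilities of the parameters `θ`. -/
def transition (θ : ∀ st : S × ℕ, Param A st.1) (st : S × ℕ) (a : A st.1) (s' : S) : ℝ :=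
  (θ st).1 a s'

variable (π : Strategy A) (θ : ∀ st : S × ℕ, Param A st.1) (s₀ : S)

lemma integral_stepKernel (t : ℕ) (h : ∀ _ : Finset.Iic t, StateAction S A)
    (g : StateAction S A → ℝ) :
    ∫ x, g x ∂(stepKernel π θ t h) =
      ∑ s', transition θ ((h ⟨t, Finset.mem_Iic.2 le_rfl⟩).state, t)
        (h ⟨t, Finset.mem_Iic.2 le_rfl⟩).action s' *
        ∑ a, π (t + 1) (fun i => h ⟨i, Finset.mem_Iic.2 (Nat.lt_succ_iff.1 i.2)⟩) s' a *
          g ⟨s', a⟩ := by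
  change ∫ x, g x ∂(weightMeasure _ _) = _
  rw [integral_weightMeasure _ _ fun _ => .of_finite]
  simp only [integral_actionLaw]
  rfl

lemma trajectoryLaw_eq_trajMeasure : trajectoryLaw π θ s₀ =
    Kernel.trajMeasure (X := fun _ => StateAction S A) (actionLaw s₀ (π 0 Fin.elim0 s₀))
      (stepKernel π θ) := rfl

instance : IsProbabilityMeasure (trajectoryLaw π θ s₀) := by
  rw [trajectoryLaw_eq_trajMeasure]; infer_instance

lemma integral_trajectoryLaw_zero (g : StateAction S A → ℝ) :
    ∫ x, g (x 0) ∂(trajectoryLaw π θ s₀) = ∑ a, π 0 Fin.elim0 s₀ a * g ⟨s₀, a⟩ := by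
  have h : (trajectoryLaw π θ s₀).map
      (Preorder.frestrictLe (π := fun _ => StateAction S A) 0) =
      (actionLaw s₀ (π 0 Fin.elim0 s₀)).map (fun x => fun _ : Finset.Iic 0 => x) := by
    rw [trajectoryLaw, Measure.map_comp _ _ (by fun_prop), Kernel.traj_map_frestrictLe,
      Kernel.partialTraj_self, Measure.id_comp]
  have h2 : ∫ x, g (x 0) ∂(trajectoryLaw π θ s₀) = ∫ y, g (y ⟨0, by simp⟩)
      ∂((trajectoryLaw π θ s₀).map (Preorder.frestrictLe (π := fun _ => StateAction S A) 0)) := by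
    rw [integral_map (by fun_prop) (measurable_of_finite _).aestronglyMeasurable]
    rfl
  rw [h2, h, integral_map (by fun_prop) (measurable_of_finite _).aestronglyMeasurable,
    integral_actionLaw]

/-- Disintegration: `stepKernel` is the conditional law of the next pair given the past. -/
lemma integral_trajectoryLaw_succ (t : ℕ)
    (g : (∀ _ : Finset.Iic t, StateAction S A) → StateAction S A → ℝ) :
    ∫ x, g (Preorder.frestrictLe (π := fun _ => StateAction S A) t x) (x (t + 1))
      ∂(trajectoryLaw π θ s₀) =
    ∫ x, (∫ y, g (Preorder.frestrictLe (π := fun _ => StateAction S A) t x) y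
      ∂(stepKernel π θ t (Preorder.frestrictLe (π := fun _ => StateAction S A) t x)))
      ∂(trajectoryLaw π θ s₀) := by
  have h := Kernel.map_frestrictLe_trajMeasure_compProd_eq_map_trajMeasure
    (X := fun _ => StateAction S A) (μ₀ := actionLaw s₀ (π 0 Fin.elim0 s₀))
    (κ := stepKernel π θ) (a := t)
  rw [← trajectoryLaw_eq_trajMeasure] at h
  have hg : Measurable (Function.uncurry g) := measurable_of_finite _
  have h2 := congrArg (fun ν => ∫ z, Function.uncurry g z ∂ν) h
  rw [integral_map (by fun_prop) hg.aestronglyMeasurable,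
    Measure.integral_compProd .of_finite,
    integral_map (by fun_prop) (measurable_of_finite _).aestronglyMeasurable] at h2
  exact h2.symm

lemma integral_trajectoryLaw (t : ℕ) (f : (Fin t → StateAction S A) → StateAction S A → ℝ) :
    ∫ x, f (fun i => x i) (x t) ∂(trajectoryLaw π θ s₀) =
      occupationMean π (transition θ) s₀ t fun h s => ∑ a, π t h s a * f h ⟨s, a⟩ := by
  induction t with
  | zero =>
    rw [occupationMean_zero, ← integral_trajectoryLaw_zero π θ s₀ (f Fin.elim0)]
    congr with x
    congr 1
    exact Subsingleton.elim _ _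
  | succ t ih =>
    rw [occupationMean_succ]
    have h := integral_trajectoryLaw_succ π θ s₀ t
      (fun h x => f (fun i => h ⟨i, Finset.mem_Iic.2 (Nat.lt_succ_iff.1 i.2)⟩) x)
    simp only [integral_stepKernel] at h
    -- Integrating out the pair of stage `t + 1` leaves a function of the pairs up to stage `t`, to
    -- which the induction hypothesis applies.
    refine h.trans (Eq.trans ?_ (ih fun h x => ∑ s', transition θ (x.state, t) x.action s' *
      ∑ a', π (t + 1) (Fin.snoc h x) s' a' * f (Fin.snoc h x) ⟨s', a'⟩))
    congr with x
    have hx : (fun i : Fin (t + 1) => x i) =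
        Fin.snoc (α := fun _ => StateAction S A) (fun i : Fin t => x i) (x t) := by
      funext i
      refine Fin.lastCases ?_ (fun j => ?_) i <;> simp
    rw [← hx]
    rfl

/-- The rewards of the parameters `θ`. -/
def reward (θ : ∀ st : S × ℕ, Param A st.1) (st : S × ℕ) (a : A st.1) : ℝ := (θ st).2 a

lemma expectedReward_eq_discountedReward {γ M : ℝ} (hγ₀ : 0 ≤ γ) (hγ₁ : γ < 1)
    (hθ : ∀ st a, |(θ st).2 a| ≤ M) :
    expectedReward γ π θ s₀ = discountedReward γ π (transition θ) (reward θ) s₀ := by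
  unfold expectedReward discountedReward
  have hmeas : ∀ t, Measurable fun x : ℕ → StateAction S A =>
      γ ^ t * (θ ((x t).state, t)).2 (x t).action := fun t =>
    (measurable_of_finite fun y : StateAction S A =>
      γ ^ t * (θ (y.state, t)).2 y.action).comp (measurable_pi_apply t)
  have hbound : ∀ t (x : ℕ → StateAction S A),
      ‖γ ^ t * (θ ((x t).state, t)).2 (x t).action‖ ≤ γ ^ t * M := fun t x => by
    rw [Real.norm_eq_abs, abs_mul, abs_of_nonneg (pow_nonneg hγ₀ t)]
    exact mul_le_mul_of_nonneg_left (hθ _ _) (pow_nonneg hγ₀ t)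
  have hint : ∀ t, Integrable (fun x : ℕ → StateAction S A =>
      γ ^ t * (θ ((x t).state, t)).2 (x t).action) (trajectoryLaw π θ s₀) := fun t =>
    Integrable.of_bound (hmeas t).aestronglyMeasurable (γ ^ t * M) (.of_forall (hbound t))
  rw [← integral_tsum_of_summable_integral_norm hint]
  · refine tsum_congr fun t => ?_
    rw [integral_const_mul]
    exact congrArg _ (integral_trajectoryLaw π θ s₀ t fun _ x => (θ (x.state, t)).2 x.action)
  · refine Summable.of_nonneg_of_le (fun t => integral_nonneg fun _ => norm_nonneg _) (fun t => ?_)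
      ((summable_geometric_of_lt_one hγ₀ hγ₁).mul_right M)
    refine (integral_mono (hint t).norm (integrable_const (γ ^ t * M)) (hbound t)).trans_eq ?_
    simp

end Trajectory

/-! ### Independence replaces random parameters by their means. -/

section Independence

variable {S : Type*} {A : S → Type*} [Fintype S] [∀ s, Fintype (A s)]

@[fun_prop]
lemma measurable_stdSimplex_apply {ι : Type*} [Fintype ι] (i : ι) :
    Measurable fun q : stdSimplex ℝ ι => q i :=
  (measurable_pi_apply i).comp measurable_subtype_coe

lemma measurable_param_transition {s : S} (a : A s) (s' : S) :
    Measurable fun ϑ : Param A s => ϑ.1 a s' :=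
  (measurable_stdSimplex_apply s').comp ((measurable_pi_apply a).comp measurable_fst)

lemma measurable_param_reward {s : S} (a : A s) : Measurable fun ϑ : Param A s => ϑ.2 a :=
  (measurable_pi_apply a).comp measurable_snd

/-- The means of the transition probabilities. -/
def meanTransition (m : ∀ s, Measure (Param A s)) (st : S × ℕ) (a : A st.1) (s' : S) : ℝ :=
  ∫ ϑ, ϑ.1 a s' ∂(m st.1)

/-- The means of the rewards. -/
def meanReward (m : ∀ s, Measure (Param A s)) (st : S × ℕ) (a : A st.1) : ℝ :=
  ∫ ϑ, ϑ.2 a ∂(m st.1)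

lemma meanTransition_nonneg (m : ∀ s, Measure (Param A s)) (st : S × ℕ) (a : A st.1) (s' : S) :
    0 ≤ meanTransition m st a s' :=
  integral_nonneg fun ϑ => stdSimplex.zero_le (ϑ.1 a) s'

variable (π : Strategy A) (s₀ : S) (m : ∀ s, Measure (Param A s)) [∀ s, IsProbabilityMeasure (m s)]

lemma integrable_param_transition {s : S} (ν : Measure (Param A s)) [IsFiniteMeasure ν] (a : A s)
    (s' : S) : Integrable (fun ϑ => ϑ.1 a s') ν :=
  Integrable.of_bound (measurable_param_transition a s').aestronglyMeasurable 1 <|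
    .of_forall fun ϑ => by
      rw [Real.norm_eq_abs, abs_of_nonneg (stdSimplex.zero_le _ _)]
      exact stdSimplex.le_one _ _

lemma sum_meanTransition (st : S × ℕ) (a : A st.1) : ∑ s', meanTransition m st a s' = 1 := by
  unfold meanTransition
  rw [← integral_finsetSum _ fun s' _ => integrable_param_transition _ a s']
  simp

/-- Here `c` collects the initial indicator and the strategy's probabilities, and `y k` is the state
entered after stage `k`; neither depends on `P`. Each stage before `t` contributes one factor, which
is the form that independence needs. -/
lemma exists_occupation_eq_prod (t : ℕ) (h : Fin t → StateAction S A) (s : S) :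
    ∃ (c : ℝ) (y : Fin t → S), ∀ P : ∀ st : S × ℕ, A st.1 → S → ℝ,
      occupation π P s₀ t h s = c * ∏ k, P ((h k).state, k) (h k).action (y k) := by
  classical
  induction t generalizing s with
  | zero => exact ⟨if s = s₀ then 1 else 0, Fin.elim0, fun P => by simp [occupation]⟩
  | succ t ih =>
    obtain ⟨c, y, hcy⟩ := ih (Fin.init h) (h (Fin.last t)).state
    refine ⟨c * π t (Fin.init h) (h (Fin.last t)).state (h (Fin.last t)).action,
      Fin.snoc y s, fun P => ?_⟩
    rw [Fin.prod_univ_castSucc, occupation, hcy]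
    simp only [Fin.snoc_castSucc, Fin.snoc_last, Fin.val_last, Fin.val_castSucc, Fin.init]
    ring

/-- The occupation probabilities of the stage `t` depend only on the parameters of the stages
before `t`, which are independent of those of the stage `t` and of each other. -/
lemma integral_occupation_mul (t : ℕ) (h : Fin t → StateAction S A) (s : S) {f : Param A s → ℝ}
    (hf : Measurable f) :
    ∫ θ, occupation π (transition θ) s₀ t h s * f (θ (s, t))
      ∂(Measure.infinitePi fun st : S × ℕ => m st.1) =
      occupation π (meanTransition m) s₀ t h s * ∫ ϑ, f ϑ ∂(m s) := by
  obtain ⟨c, y, hcy⟩ := exists_occupation_eq_prod π s₀ t h s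
  simp only [hcy, mul_assoc]
  rw [integral_const_mul]
  congr 1
  -- The coordinates of `θ` that occur: index `0` for `f`, the others for the past transitions. They
  -- are distinct because their stages are, even when a state is revisited.
  let e : Fin (t + 1) → S × ℕ := Fin.cases (s, t) fun k => ((h k).state, k)
  have he : Function.Injective e := by
    intro i j
    refine Fin.cases ?_ (fun i => ?_) i <;> refine Fin.cases ?_ (fun j => ?_) j <;> intro hij <;>
      have h2 := congrArg Prod.snd hij
    · rfl
    · exact absurd h2 j.2.ne'
    · exact absurd h2 i.2.ne
    · exact congrArg _ (Fin.ext h2)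
  let F : ∀ k, Param A (e k).1 → ℝ := Fin.cases f fun k ϑ => ϑ.1 (h k).action (y k)
  have hF : ∀ k, Measurable (F k) := Fin.cases hf fun k => measurable_param_transition _ _
  have hind : iIndepFun (fun k (θ : ∀ st : S × ℕ, Param A st.1) => θ (e k))
      (Measure.infinitePi fun st : S × ℕ => m st.1) :=
    (iIndepFun_infinitePi (X := fun st (ϑ : Param A (Prod.fst st)) => ϑ)
      fun _ => measurable_id).precomp he
  have key := hind.integral_fun_prod_comp (fun k => (measurable_pi_apply (e k)).aemeasurable)
    (f := F) fun k => (hF k).aestronglyMeasurable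
  have hmarg : ∀ k, ∫ θ, F k (θ (e k)) ∂(Measure.infinitePi fun st : S × ℕ => m st.1) =
      ∫ ϑ, F k ϑ ∂(m (e k).1) := fun k => by
    have hmap := integral_map (μ := Measure.infinitePi fun st : S × ℕ => m st.1)
      (measurable_pi_apply (e k)).aemeasurable (hF k).aestronglyMeasurable
    rw [Measure.infinitePi_map_eval] at hmap
    exact hmap.symm
  simp only [hmarg] at key
  simp only [Fin.prod_univ_succ] at key
  rw [mul_comm (∏ k, _)]
  refine Eq.trans (integral_congr_ae (.of_forall fun θ => ?_)) key
  exact mul_comm _ _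

lemma measurable_occupation_transition (t : ℕ) (h : Fin t → StateAction S A) (s : S) :
    Measurable fun θ : ∀ st : S × ℕ, Param A st.1 => occupation π (transition θ) s₀ t h s := by
  induction t generalizing s with
  | zero => exact measurable_const
  | succ t ih =>
    exact ((ih _ _).mul_const _).mul
      ((measurable_param_transition _ _).comp (measurable_pi_apply _))

lemma occupation_le_one {P : ∀ st : S × ℕ, A st.1 → S → ℝ} (hP₀ : ∀ st a s', 0 ≤ P st a s')
    (hP₁ : ∀ st a s', P st a s' ≤ 1) (t : ℕ) (h : Fin t → StateAction S A) (s : S) :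
    occupation π P s₀ t h s ≤ 1 := by
  induction t generalizing s with
  | zero => simp only [occupation]; split_ifs <;> norm_num
  | succ t ih =>
    exact mul_le_one₀ (mul_le_one₀ (ih _ _) (stdSimplex.zero_le _ _) (stdSimplex.le_one _ _))
      (hP₀ _ _ _) (hP₁ _ _ _)

variable {γ M : ℝ}

lemma ae_abs_reward_le (hM : ∀ s, ∀ᵐ ϑ ∂(m s), ∀ a, |ϑ.2 a| ≤ M) :
    ∀ᵐ θ ∂(Measure.infinitePi fun st : S × ℕ => m st.1), ∀ st a, |(θ st).2 a| ≤ M := by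
  rw [ae_all_iff]
  intro st
  exact (measurePreserving_eval_infinitePi (fun st : S × ℕ => m st.1)
    st).quasiMeasurePreserving.ae (hM st.1)

lemma measurable_stageReward (t : ℕ) (h : Fin t → StateAction S A) (s : S) :
    Measurable fun ϑ : Param A s => ∑ a, π t h s a * ϑ.2 a :=
  Finset.measurable_fun_sum _ fun a _ => (measurable_param_reward a).const_mul _

lemma integral_stageReward (hM : ∀ s, ∀ᵐ ϑ ∂(m s), ∀ a, |ϑ.2 a| ≤ M) (t : ℕ) :
    ∫ θ, (occupationMean π (transition θ) s₀ t fun h s => ∑ a, π t h s a * reward θ (s, t) a)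
      ∂(Measure.infinitePi fun st : S × ℕ => m st.1) =
    occupationMean π (meanTransition m) s₀ t fun h s =>
      ∑ a, π t h s a * meanReward m (s, t) a := by
  have hint : ∀ (h : Fin t → StateAction S A) s, Integrable
      (fun θ : ∀ st : S × ℕ, Param A st.1 => occupation π (transition θ) s₀ t h s *
        ∑ a, π t h s a * reward θ (s, t) a) (Measure.infinitePi fun st : S × ℕ => m st.1) := by
    intro h s
    refine Integrable.of_bound ((measurable_occupation_transition π s₀ t h s).mul
      ((measurable_stageReward π t h s).comp (measurable_pi_apply (s, t)))).aestronglyMeasurable M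
      ?_
    filter_upwards [ae_abs_reward_le m hM] with θ hθ
    have h0 : 0 ≤ occupation π (transition θ) s₀ t h s :=
      occupation_nonneg (fun st a s' => stdSimplex.zero_le ((θ st).1 a) s') t h s
    have h1 : occupation π (transition θ) s₀ t h s ≤ 1 :=
      occupation_le_one π s₀ (fun st a s' => stdSimplex.zero_le ((θ st).1 a) s')
        (fun st a s' => stdSimplex.le_one ((θ st).1 a) s') t h s
    rw [Real.norm_eq_abs, abs_mul, abs_of_nonneg h0]
    exact (mul_le_of_le_one_left (abs_nonneg _) h1).trans
      (abs_sum_stdSimplex_mul_le (π t h s) (hθ (s, t)))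
  unfold occupationMean
  rw [integral_finsetSum _ fun h _ => integrable_finsetSum _ fun s _ => hint h s]
  refine Finset.sum_congr rfl fun h _ => ?_
  rw [integral_finsetSum _ fun s _ => hint h s]
  refine Finset.sum_congr rfl fun s _ => ?_
  refine (integral_occupation_mul π s₀ m t h s (measurable_stageReward π t h s)).trans ?_
  rw [integral_finsetSum]
  · simp only [integral_const_mul]
    rfl
  · intro a _
    refine (Integrable.of_bound (measurable_param_reward a).aestronglyMeasurable M ?_).const_mul _
    filter_upwards [hM s] with ϑ hϑ using hϑ a

/-- The expected performance is the discounted reward for the mean parameters. -/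
lemma performance_infinitePi (hγ₀ : 0 ≤ γ) (hγ₁ : γ < 1)
    (hM : ∀ s, ∀ᵐ ϑ ∂(m s), ∀ a, |ϑ.2 a| ≤ M) :
    performance γ π (Measure.infinitePi fun st : S × ℕ => m st.1) s₀ =
      discountedReward γ π (meanTransition m) (meanReward m) s₀ := by
  unfold performance
  have hae := ae_abs_reward_le m hM
  -- The formula for fixed parameters needs bounded rewards, which almost every `θ` has.
  rw [integral_congr_ae (hae.mono fun θ hθ =>
    expectedReward_eq_discountedReward π θ s₀ hγ₀ hγ₁ hθ)]
  unfold discountedReward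
  set μ := Measure.infinitePi fun st : S × ℕ => m st.1
  have hbound : ∀ t, ∀ᵐ θ ∂μ, ‖γ ^ t * occupationMean π (transition θ) s₀ t fun h s =>
      ∑ a, π t h s a * reward θ (s, t) a‖ ≤ γ ^ t * M := fun t => by
    filter_upwards [hae] with θ hθ
    rw [Real.norm_eq_abs, abs_mul, abs_of_nonneg (pow_nonneg hγ₀ t)]
    exact mul_le_mul_of_nonneg_left (abs_stageReward_le
      (fun st a s' => stdSimplex.zero_le ((θ st).1 a) s')
      (fun st a => stdSimplex.sum_eq_one ((θ st).1 a)) hθ t) (pow_nonneg hγ₀ t)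
  have hint : ∀ t, Integrable (fun θ => γ ^ t * occupationMean π (transition θ) s₀ t fun h s =>
      ∑ a, π t h s a * reward θ (s, t) a) μ := fun t =>
    Integrable.of_bound (Measurable.const_mul (Finset.measurable_fun_sum _ fun h _ =>
      Finset.measurable_fun_sum _ fun s _ => (measurable_occupation_transition π s₀ t h s).mul
        ((measurable_stageReward π t h s).comp
          (measurable_pi_apply (s, t)))) _).aestronglyMeasurable _ (hbound t)
  rw [← integral_tsum_of_summable_integral_norm hint]
  · refine tsum_congr fun t => ?_
    rw [integral_const_mul, integral_stageReward π s₀ m hM t]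
  · refine Summable.of_nonneg_of_le (fun t => integral_nonneg fun _ => norm_nonneg _) (fun t => ?_)
      ((summable_geometric_of_lt_one hγ₀ hγ₁).mul_right M)
    refine (integral_mono_ae (hint t).norm (integrable_const (γ ^ t * M)) (hbound t)).trans_eq ?_
    simp

end Independence

/-! ### Boundedness and convexity of the ambiguity sets, and a minimax theorem. -/

section Ambiguity

variable {S : Type*} {A : S → Type*} [Fintype S] [∀ s, Fintype (A s)]

lemma measurable_toAmbient {Q : ℕ} {s : S} :
    Measurable (LiftedParam.toAmbient : LiftedParam A Q s → Ambient A Q s) := by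
  refine Measurable.prodMk (measurable_pi_lambda _ fun as => ?_) measurable_snd
  exact (measurable_stdSimplex_apply as.2).comp ((measurable_pi_apply as.1).comp measurable_fst)

lemma measurable_marginal {Q : ℕ} {s : S} :
    Measurable fun θ : LiftedParam A Q s => ((θ.1, θ.2.1) : Param A s) := by fun_prop

variable {D : AmbiguityData S A}

/-- Closedness makes the confidence sets measurable, so that probability one becomes an almost-sure
statement. -/
lemma AmbiguityData.ConicRepresentable.isClosed (hD : D.ConicRepresentable) (s : S)
    (i : Fin (D.n s + 1)) : IsClosed (D.O s i) := by
  obtain ⟨-, -, L, B, R, E, b, K, hK, hO⟩ := hD s i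
  rw [hO]
  exact hK.1.preimage (f := fun z : Ambient A (D.Q s) s =>
    b - (B.mulVec z.1 + R.mulVec z.2.1 + E.mulVec z.2.2)) (by fun_prop)

lemma isProbabilityMeasure_of_mem_ambiguitySet {s : S} {ν : Measure (Param A s)}
    (hν : ν ∈ D.ambiguitySet s) : IsProbabilityMeasure ν := by
  obtain ⟨μ, ⟨hμ, -⟩, rfl⟩ := hν
  exact Measure.isProbabilityMeasure_map measurable_marginal.aemeasurable

lemma measurableSet_abs_reward_le (s : S) (M : ℝ) :
    MeasurableSet {ϑ : Param A s | ∀ a, |ϑ.2 a| ≤ M} := by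
  rw [Set.ofPred_forall]
  exact MeasurableSet.iInter fun a =>
    measurableSet_le ((measurable_param_reward a).norm) measurable_const

/-- Under bounded support, the rewards are uniformly bounded with probability one. -/
lemma exists_abs_reward_le (hD : D.ConicRepresentable) (hb : D.BoundedSupport) :
    ∃ M, ∀ s, ∀ ν ∈ D.ambiguitySet s, ∀ᵐ ϑ ∂ν, ∀ a, |ϑ.2 a| ≤ M := by
  choose C hC using fun s => isBounded_iff_forall_norm_le.1 (hb s).1
  refine ⟨∑ s, |C s|, fun s ν hν => ?_⟩
  obtain ⟨μ, ⟨hμ, -, -, hα⟩, rfl⟩ := hν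
  rw [ae_map_iff measurable_marginal.aemeasurable (measurableSet_abs_reward_le s _)]
  have h1 : μ.real {θ | θ.toAmbient ∈ D.O s (Fin.last (D.n s))} = 1 := by
    have h := hα (Fin.last (D.n s))
    rw [(hb s).2.1, (hb s).2.2] at h
    exact le_antisymm h.2 h.1
  have h2 : ∀ᵐ θ ∂μ, θ.toAmbient ∈ D.O s (Fin.last (D.n s)) := by
    refine (mem_ae_iff_prob_eq_one
      (measurable_toAmbient (hD.isClosed s (Fin.last (D.n s))).measurableSet)).2 ?_
    rw [Measure.real, ENNReal.toReal_eq_one_iff] at h1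
    exact h1
  filter_upwards [h2] with θ hθ a
  calc |θ.2.1 a| ≤ ‖θ.2.1‖ := norm_le_pi_norm θ.2.1 a
    _ ≤ ‖θ.toAmbient.2‖ := le_max_left _ _
    _ ≤ ‖θ.toAmbient‖ := le_max_right _ _
    _ ≤ C s := hC s _ hθ
    _ ≤ |C s| := le_abs_self _
    _ ≤ ∑ s, |C s| := Finset.single_le_sum (f := fun s => |C s|) (fun _ _ => abs_nonneg _)
        (Finset.mem_univ s)

/-- Each defining condition puts a linear function of the measure into a convex set, and taking
marginals is linear. -/
lemma convexCombo_mem_ambiguitySet {s : S} {ν₁ ν₂ : Measure (Param A s)}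
    (h₁ : ν₁ ∈ D.ambiguitySet s) (h₂ : ν₂ ∈ D.ambiguitySet s) {a b : ℝ} (ha : 0 ≤ a) (hb : 0 ≤ b)
    (hab : a + b = 1) : ENNReal.ofReal a • ν₁ + ENNReal.ofReal b • ν₂ ∈ D.ambiguitySet s := by
  obtain ⟨μ₁, ⟨hp₁, hi₁, hc₁, hα₁⟩, rfl⟩ := h₁
  obtain ⟨μ₂, ⟨hp₂, hi₂, hc₂, hα₂⟩, rfl⟩ := h₂
  have hj₁ := hi₁.smul_measure (c := ENNReal.ofReal a) ENNReal.ofReal_ne_top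
  have hj₂ := hi₂.smul_measure (c := ENNReal.ofReal b) ENNReal.ofReal_ne_top
  refine ⟨ENNReal.ofReal a • μ₁ + ENNReal.ofReal b • μ₂, ⟨⟨?_⟩, hj₁.add_measure hj₂, ?_, ?_⟩, ?_⟩
  · simp [← ENNReal.ofReal_add ha hb, hab]
  · rw [integral_add_measure hj₁ hj₂, integral_smul_measure, integral_smul_measure, hc₁, hc₂,
      ENNReal.toReal_ofReal ha, ENNReal.toReal_ofReal hb, ← add_smul, hab, one_smul]
  · intro i
    have := Measure.smul_finite μ₁ (c := ENNReal.ofReal a) ENNReal.ofReal_ne_top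
    have := Measure.smul_finite μ₂ (c := ENNReal.ofReal b) ENNReal.ofReal_ne_top
    rw [measureReal_add_apply, measureReal_ennreal_smul_apply,
      measureReal_ennreal_smul_apply, ENNReal.toReal_ofReal ha, ENNReal.toReal_ofReal hb]
    exact convex_Icc _ _ (hα₁ i) (hα₂ i) ha hb hab
  · simp only [Measure.map_add _ _ measurable_marginal, Measure.map_smul]

/-- The expectation of the value `r (s, a) + γ v (s')` of the action `a`. -/
def actionValue (γ : ℝ) (v : S → ℝ) (s : S) (ν : Measure (Param A s)) (a : A s) : ℝ :=
  ∫ ϑ, ϑ.2 a ∂ν + γ * ∑ s', (∫ ϑ, ϑ.1 a s' ∂ν) * v s'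

lemma integrable_param_reward {s : S} {ν : Measure (Param A s)} [IsFiniteMeasure ν] {M : ℝ}
    (hM : ∀ᵐ ϑ ∂ν, ∀ a, |ϑ.2 a| ≤ M) (a : A s) : Integrable (fun ϑ => ϑ.2 a) ν :=
  Integrable.of_bound (measurable_param_reward a).aestronglyMeasurable M (hM.mono fun _ h => h a)

lemma oneStepValue_eq_sum (γ : ℝ) (v : S → ℝ) {s : S} {ν : Measure (Param A s)}
    [IsFiniteMeasure ν] {M : ℝ} (hM : ∀ᵐ ϑ ∂ν, ∀ a, |ϑ.2 a| ≤ M) (d : stdSimplex ℝ (A s)) :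
    oneStepValue γ v s d ν = ∑ a, d a * actionValue γ v s ν a := by
  have hp : ∀ a, Integrable (fun ϑ : Param A s => ∑ s', ϑ.1 a s' * v s') ν := fun a =>
    integrable_finsetSum _ fun s' _ => (integrable_param_transition ν a s').mul_const _
  unfold oneStepValue actionValue
  have hsum : ∀ a, Integrable
      (fun ϑ : Param A s => d a * (ϑ.2 a + γ * ∑ s', ϑ.1 a s' * v s')) ν := fun a =>
    ((integrable_param_reward hM a).add ((hp a).const_mul γ)).const_mul (d a)
  rw [integral_finsetSum _ fun a _ => hsum a]
  refine Finset.sum_congr rfl fun a _ => ?_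
  rw [integral_const_mul, integral_add (integrable_param_reward hM a) ((hp a).const_mul γ),
    integral_const_mul, integral_finsetSum _ fun s' _ =>
      (integrable_param_transition ν a s').mul_const _]
  simp only [integral_mul_const]

lemma actionValue_convexCombo (γ : ℝ) (v : S → ℝ) {s : S} {ν₁ ν₂ : Measure (Param A s)}
    [IsFiniteMeasure ν₁] [IsFiniteMeasure ν₂] {M : ℝ} (h₁ : ∀ᵐ ϑ ∂ν₁, ∀ a, |ϑ.2 a| ≤ M)
    (h₂ : ∀ᵐ ϑ ∂ν₂, ∀ a, |ϑ.2 a| ≤ M) {a b : ℝ} (ha : 0 ≤ a) (hb : 0 ≤ b) (x : A s) :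
    actionValue γ v s (ENNReal.ofReal a • ν₁ + ENNReal.ofReal b • ν₂) x =
      a * actionValue γ v s ν₁ x + b * actionValue γ v s ν₂ x := by
  have key : ∀ f : Param A s → ℝ, Integrable f ν₁ → Integrable f ν₂ →
      ∫ ϑ, f ϑ ∂(ENNReal.ofReal a • ν₁ + ENNReal.ofReal b • ν₂) =
        a * ∫ ϑ, f ϑ ∂ν₁ + b * ∫ ϑ, f ϑ ∂ν₂ := fun f hf₁ hf₂ => by
    rw [integral_add_measure (hf₁.smul_measure ENNReal.ofReal_ne_top)
      (hf₂.smul_measure ENNReal.ofReal_ne_top), integral_smul_measure, integral_smul_measure,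
      ENNReal.toReal_ofReal ha, ENNReal.toReal_ofReal hb, smul_eq_mul, smul_eq_mul]
  unfold actionValue
  rw [key _ (integrable_param_reward h₁ x) (integrable_param_reward h₂ x)]
  simp only [key _ (integrable_param_transition ν₁ x _) (integrable_param_transition ν₂ x _),
    add_mul, Finset.sum_add_distrib, mul_assoc, ← Finset.mul_sum]
  ring

/-- A minimax theorem: if for every mixed action a convex set contains a payoff vector whose mean
is below `c`, then it contains a payoff vector all of whose coordinates are below `c`. -/
lemma exists_forall_lt_of_forall_stdSimplex {ι : Type*} [Fintype ι] {Y : Set (ι → ℝ)}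
    (hY : Convex ℝ Y) (hne : Y.Nonempty) {c : ℝ}
    (h : ∀ d : stdSimplex ℝ ι, ∃ y ∈ Y, ∑ i, d i * y i < c) : ∃ y ∈ Y, ∀ i, y i < c := by
  classical
  -- The goal says that the constant vector `c` lies in this open convex set; otherwise a hyperplane
  -- separates them, and its normal `w` normalizes to a mixed action that contradicts `h`.
  set U : Set (ι → ℝ) := {z | ∃ y ∈ Y, ∀ i, y i < z i} with hU
  have hopen : IsOpen U := by
    have : U = ⋃ y ∈ Y, Set.univ.pi fun i => Set.Ioi (y i) := by ext z; simp [hU]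
    rw [this]
    exact isOpen_biUnion fun y _ => isOpen_set_pi Set.finite_univ fun i _ => isOpen_Ioi
  have hconv : Convex ℝ U := by
    rintro z₁ ⟨y₁, hy₁, hz₁⟩ z₂ ⟨y₂, hy₂, hz₂⟩ a b ha hb hab
    refine ⟨a • y₁ + b • y₂, hY hy₁ hy₂ ha hb hab, fun i => ?_⟩
    have hlt : a * (z₁ i - y₁ i) + b * (z₂ i - y₂ i) > 0 := by
      rcases ha.eq_or_lt with rfl | ha
      · have : b = 1 := by linarith
        subst this
        linarith [hz₂ i]
      · have := mul_pos ha (sub_pos.2 (hz₁ i))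
        have := mul_nonneg hb (sub_pos.2 (hz₂ i)).le
        linarith
    simp only [Pi.add_apply, Pi.smul_apply, smul_eq_mul]
    linarith
  by_contra hcon
  have hc : (fun _ => c) ∉ U := hcon
  obtain ⟨f, hf⟩ := geometric_hahn_banach_open_point hconv hopen hc
  set w : ι → ℝ := fun i => -f (Pi.single i 1) with hw
  have hfw : ∀ y, f y = -∑ i, w i * y i := fun y => by
    have : y = ∑ i, y i • Pi.single (M := fun _ : ι => ℝ) i 1 := by
      ext j; simp [Finset.sum_apply, Pi.single_apply]
    conv_lhs => rw [this]
    simp [hw, mul_comm]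
  have hup : ∀ y ∈ Y, ∀ z : ι → ℝ, (∀ i, 0 < z i) →
      (∑ i, w i) * c < ∑ i, w i * y i + ∑ i, w i * z i := by
    intro y hy z hz
    have h1 := hf (fun i => y i + z i) ⟨y, hy, fun i => lt_add_of_pos_right _ (hz i)⟩
    rw [hfw, hfw, neg_lt_neg_iff] at h1
    simpa [mul_add, Finset.sum_add_distrib, Finset.sum_mul] using h1
  obtain ⟨y₀, hy₀⟩ := hne
  have hw₀ : ∀ i, 0 ≤ w i := by
    intro i
    by_contra! hi
    set B : ℝ := ∑ i, w i * y₀ i + ∑ i, w i - (∑ i, w i) * c with hB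
    -- A negative `w i` would let a large step along coordinate `i` cross the hyperplane; this step
    -- length turns `hup` into `|B| < B`.
    have h1 := hup y₀ hy₀ (fun j => 1 + if j = i then |B| / -w i else 0) fun j => by
      have : 0 ≤ |B| / -w i := div_nonneg (abs_nonneg _) (by linarith)
      split_ifs <;> linarith
    simp only [mul_add, mul_one, Finset.sum_add_distrib, mul_ite, mul_zero, Finset.sum_ite_eq',
      Finset.mem_univ, if_true] at h1
    have h2 : w i * (|B| / -w i) = -|B| := by
      rw [div_neg, mul_neg, mul_div_cancel₀ _ hi.ne]
    rw [h2] at h1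
    linarith [le_abs_self B]
  have hwpos : 0 < ∑ i, w i := by
    refine (Finset.sum_nonneg fun i _ => hw₀ i).lt_of_ne' fun h0 => ?_
    have h1 : ∀ i, w i = 0 := fun i =>
      (Finset.sum_eq_zero_iff_of_nonneg fun i _ => hw₀ i).1 h0 i (Finset.mem_univ i)
    have := hup y₀ hy₀ (fun _ => 1) fun _ => one_pos
    simp [h1] at this
  obtain ⟨y, hy, hlt⟩ := h ⟨fun i => w i / ∑ i, w i,
    fun i => div_nonneg (hw₀ i) hwpos.le, by rw [← Finset.sum_div, div_self hwpos.ne']⟩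
  have hlt' : ∑ i, w i / (∑ i, w i) * y i < c := hlt
  simp only [div_mul_eq_mul_div, ← Finset.sum_div] at hlt'
  rw [div_lt_iff₀ hwpos] at hlt'
  -- Raising every coordinate of `y` by this gap lands exactly on the hyperplane, which `hup`
  -- forbids.
  set δ : ℝ := (c * ∑ i, w i - ∑ i, w i * y i) / ∑ i, w i with hδ
  have := hup y hy (fun _ => δ) fun _ => div_pos (by linarith) hwpos
  rw [← Finset.sum_mul, hδ, mul_div_cancel₀ _ hwpos.ne'] at this
  linarith

end Ambiguity

/-! ### Upper and lower bounds on the performance by the S-robust value. -/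

section Robustness

variable {S : Type*} {A : S → Type*} [Fintype S] [∀ s, Fintype (A s)] {D : AmbiguityData S A}
  {γ : ℝ} {v : S → ℝ}

/-- An infimum over the empty set is `⊤` in `EReal`, whereas `v s` is real. -/
lemma IsSRobustValue.ambiguitySet_nonempty (hv : IsSRobustValue D γ v) (s : S) :
    (D.ambiguitySet s).Nonempty := by
  by_contra hne
  obtain ⟨⟨d, hd⟩, -⟩ := hv s
  simp [worstOneStepValue, Set.not_nonempty_iff_eq_empty.1 hne] at hd

/-- Against some member of the ambiguity set, no action does better than `v s + ε`. -/
lemma IsSRobustValue.exists_forall_actionValue_lt (hv : IsSRobustValue D γ v) {M : ℝ}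
    (hM : ∀ s, ∀ ν ∈ D.ambiguitySet s, ∀ᵐ ϑ ∂ν, ∀ a, |ϑ.2 a| ≤ M) (s : S) {ε : ℝ} (hε : 0 < ε) :
    ∃ ν ∈ D.ambiguitySet s, ∀ a, actionValue γ v s ν a < v s + ε := by
  have hconv : Convex ℝ (actionValue γ v s '' D.ambiguitySet s) := by
    rintro _ ⟨ν₁, h₁, rfl⟩ _ ⟨ν₂, h₂, rfl⟩ a b ha hb hab
    have := isProbabilityMeasure_of_mem_ambiguitySet h₁
    have := isProbabilityMeasure_of_mem_ambiguitySet h₂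
    exact ⟨_, convexCombo_mem_ambiguitySet h₁ h₂ ha hb hab,
      funext (actionValue_convexCombo γ v (hM s _ h₁) (hM s _ h₂) ha hb)⟩
  obtain ⟨_, ⟨ν, hν, rfl⟩, h⟩ := exists_forall_lt_of_forall_stdSimplex hconv
    ((hv.ambiguitySet_nonempty s).image _) (c := v s + ε) fun d => by
      -- As `v s` is the greatest worst-case value, `d` falls below `v s + ε` against some member,
      -- which may depend on `d`; the minimax theorem removes this dependence.
      have h1 : worstOneStepValue D γ v s d < ((v s + ε : ℝ) : EReal) :=
        ((hv s).2 ⟨d, rfl⟩).trans_lt (EReal.coe_lt_coe_iff.2 (lt_add_of_pos_right _ hε))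
      simp only [worstOneStepValue, iInf_lt_iff] at h1
      obtain ⟨ν, hν, hlt⟩ := h1
      have := isProbabilityMeasure_of_mem_ambiguitySet hν
      rw [EReal.coe_lt_coe_iff, oneStepValue_eq_sum γ v (hM s ν hν)] at hlt
      exact ⟨_, ⟨ν, hν, rfl⟩, hlt⟩
  exact ⟨ν, hν, h⟩

lemma IsSRobustAction.le_oneStepValue (hv : IsSRobustValue D γ v) {s : S} {d : stdSimplex ℝ (A s)}
    (hd : IsSRobustAction D γ v s d) {ν : Measure (Param A s)} (hν : ν ∈ D.ambiguitySet s) :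
    v s ≤ oneStepValue γ v s d ν := by
  obtain ⟨⟨d', hd'⟩, -⟩ := hv s
  rw [← EReal.coe_le_coe_iff, ← hd']
  exact (hd d').trans (iInf₂_le ν hν)

lemma abs_meanReward_le {m : ∀ s, Measure (Param A s)} [∀ s, IsProbabilityMeasure (m s)] {M : ℝ}
    (hM : ∀ s, ∀ᵐ ϑ ∂(m s), ∀ a, |ϑ.2 a| ≤ M) (st : S × ℕ) (a : A st.1) :
    |meanReward m st a| ≤ M := by
  refine (norm_integral_le_of_norm_le_const (f := fun ϑ : Param A st.1 => ϑ.2 a) (C := M)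
    ((hM st.1).mono fun ϑ h => h a)).trans_eq ?_
  simp

lemma le_performance (hγ₀ : 0 ≤ γ) (hγ₁ : γ < 1) (hv : IsSRobustValue D γ v) {M : ℝ}
    (hM : ∀ s, ∀ ν ∈ D.ambiguitySet s, ∀ᵐ ϑ ∂ν, ∀ a, |ϑ.2 a| ≤ M) {π : Strategy A}
    (hπ : ∀ t h s, IsSRobustAction D γ v s (π t h s)) {m : ∀ s, Measure (Param A s)}
    (hm : ∀ s, m s ∈ D.ambiguitySet s) (s₀ : S) :
    v s₀ ≤ performance γ π (Measure.infinitePi fun st : S × ℕ => m st.1) s₀ := by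
  have := fun s => isProbabilityMeasure_of_mem_ambiguitySet (hm s)
  have hMm := fun s => hM s (m s) (hm s)
  rw [performance_infinitePi π s₀ m hγ₀ hγ₁ hMm]
  have h := le_discountedReward (π := π) (s₀ := s₀) (ε := 0) (v := v) hγ₀ hγ₁
    (meanTransition_nonneg m) (sum_meanTransition m) (abs_meanReward_le hMm) fun t h s => by
      have h1 := (hπ t h s).le_oneStepValue hv (hm s)
      rw [oneStepValue_eq_sum γ v (hMm s)] at h1
      rw [sub_zero]
      -- `actionValue` unfolds to the one-step value of the mean parameters.
      exact h1
  simpa using h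

lemma performance_le (hγ₀ : 0 ≤ γ) (hγ₁ : γ < 1) {M ε : ℝ} {m : ∀ s, Measure (Param A s)}
    [∀ s, IsProbabilityMeasure (m s)] (hM : ∀ s, ∀ᵐ ϑ ∂(m s), ∀ a, |ϑ.2 a| ≤ M)
    (hm : ∀ s a, actionValue γ v s (m s) a ≤ v s + ε) (π : Strategy A) (s₀ : S) :
    performance γ π (Measure.infinitePi fun st : S × ℕ => m st.1) s₀ ≤ v s₀ + ε / (1 - γ) := by
  rw [performance_infinitePi π s₀ m hγ₀ hγ₁ hM]
  refine discountedReward_le hγ₀ hγ₁ (meanTransition_nonneg m) (sum_meanTransition m)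
    (abs_meanReward_le hM) fun t h s => ?_
  calc ∑ a, π t h s a * actionValue γ v s (m s) a ≤ ∑ a, π t h s a * (v s + ε) :=
        Finset.sum_le_sum fun a _ =>
          mul_le_mul_of_nonneg_left (hm s a) (stdSimplex.zero_le _ _)
    _ = v s + ε := by rw [← Finset.sum_mul, stdSimplex.sum_eq_one, one_mul]

end Robustness

end DAMDP

end

/-! ### Distributional robustness, with `v s₀` separating the two infima. -/

theorem theorem4 {S : Type*} [Fintype S] {A : S → Type*} [∀ s, Fintype (A s)]
    (D : DAMDP.AmbiguityData S A) (hconic : D.ConicRepresentable) (hbdd : D.BoundedSupport)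
    (γ : ℝ) (hγ₀ : 0 ≤ γ) (hγ₁ : γ < 1)
    (π : DAMDP.Strategy A) (hπ : DAMDP.IsSRobustStrategy D γ π) (s₀ : S) :
    DAMDP.IsDistributionallyRobust γ D.stationaryAmbiguitySet s₀ π := by
  obtain ⟨v, hv, hact⟩ := hπ
  obtain ⟨M, hM⟩ := DAMDP.exists_abs_reward_le hconic hbdd
  intro π'
  refine le_trans (b := (v s₀ : EReal)) ?_ ?_
  · refine EReal.le_of_forall_lt_iff_le.1 fun c hc => ?_
    -- This is the `ε` for which `ε / (1 - γ) = c - v s₀`.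
    have hpos : 0 < (c - v s₀) * (1 - γ) :=
      mul_pos (sub_pos.2 (EReal.coe_lt_coe_iff.1 hc)) (sub_pos.2 hγ₁)
    choose m hm hlt using fun s => hv.exists_forall_actionValue_lt hM s hpos
    have := fun s => DAMDP.isProbabilityMeasure_of_mem_ambiguitySet (hm s)
    refine (iInf₂_le _ ⟨m, hm, rfl⟩).trans (EReal.coe_le_coe_iff.2 ?_)
    have h := DAMDP.performance_le hγ₀ hγ₁ (fun s => hM s (m s) (hm s))
      (fun s a => (hlt s a).le) π' s₀
    rwa [mul_div_cancel_right₀ _ (sub_pos.2 hγ₁).ne', add_sub_cancel] at h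
  · refine le_iInf₂ ?_
    rintro _ ⟨m, hm, rfl⟩
    exact EReal.coe_le_coe_iff.2 (DAMDP.le_performance hγ₀ hγ₁ hv hM hact hm s₀)
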